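/- Let $E$ be a measurable space whose diagonal $\{(x,x):x\in E\}$ is measurable in $E\times E$ (for instance a standard Borel space), let $\pi$ be a probability measure on $E$, and let $\Delta=\{x\in E:\pi(\{x\})>0\}$ be its set of atoms. Assume that $\Delta$ is infinite and that the conditional distribution $\pi^*=\pi|_\Delta/\pi(\Delta)$ is regular with index $\gamma^*\in[0,1]$, meaning that its counting function $A(t)=\#\{x:\pi^*(\{x\})\ge 1/t\}$ is regularly varying at infinity with index $\gamma^*$: $\lim_{t\to\infty}A(ct)/A(t)=c^{\gamma^*}$ for every $c>0$. Let $\xi_1,\xi_2,\dots$ be i.i.d. random variables with law $\pi$. Put $N_n(x)=\#\{1\le i\le n:\xi_i=x\}$, let $R_n$ be the number of distinct elements among $\xi_1,\dots,\xi_n$, and for $k\ge1$ let $R_{n,k}$ (resp. $R_{n,k+}$) be the number of $x\in E$ with $N_n(x)=k$ (resp. $N_n(x)\ge k$). Put $r_k(\gamma)=\dfrac{\gamma\,\Gamma(k-\gamma)}{k!\,\Gamma(1-\gamma)}$ for $0<\gamma<1$. Then almost surely $$\lim_{n\to\infty}\frac{R_n}{n}=\lim_{n\to\infty}\frac{R_{n,1}}{n}=1-\pi(\Delta),$$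 and, for every $k\ge 2$, $R_{n,2+}$ and $R_{n,k+}$ are positive for all sufficiently large $n$ and $$\lim_{n\to\infty}\frac{R_{n,k}}{R_{n,2+}}=\begin{cases}\dfrac{r_k(\gamma^*)}{1-\gamma^*}, & 0<\gamma^*<1,\\[1ex] 0,&\gamma^*=0,\\[1ex] \dfrac{1}{k(k-1)},&\gamma^*=1,\end{cases}\qquad \lim_{n\to\infty}\frac{R_{n,k}}{R_{n,k+}}=\begin{cases}\dfrac{\gamma^*}{k},&0<\gamma^*\le1,\\[1ex] 0,&\gamma^*=0.\end{cases}$$ -/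

import Mathlib

open MeasureTheory ProbabilityTheory Filter Topology

noncomputable section

namespace RangeRenewal

/-- The set `Δ = {x : π {x} > 0}` of atoms of `π`. -/
def atoms {E : Type*} [MeasurableSpace E] (π : Measure E) : Set E :=
  {x | 0 < π {x}}

/-- The conditional distribution `π* = π|_Δ / π(Δ)` of `π` given its set of atoms. -/
def atomicPart {E : Type*} [MeasurableSpace E] (π : Measure E) : Measure E :=
  (π (atoms π))⁻¹ • π.restrict (atoms π)

/-- The counting function `t ↦ #{x : μ {x} ≥ 1 / t}`. For a probability measure `μ` and `t > 0`
this set is finite, with at most `t` elements. -/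
def atomCount {E : Type*} [MeasurableSpace E] (μ : Measure E) (t : ℝ) : ℕ :=
  {x : E | 1 / t ≤ μ.real {x}}.ncard

/-- `f` is regularly varying at infinity with index `γ`: `f (c t) / f t → c ^ γ` as `t → ∞`,
for every `c > 0`. -/
def IsRegularlyVarying (f : ℝ → ℝ) (γ : ℝ) : Prop :=
  ∀ c : ℝ, 0 < c → Tendsto (fun t : ℝ => f (c * t) / f t) atTop (𝓝 (c ^ γ))

/-- A discrete distribution `μ` is regular with index `γ ∈ [0, 1]` if its counting function
`t ↦ #{x : μ {x} ≥ 1 / t}` is regularly varying at infinity with index `γ`. -/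
def IsRegular {E : Type*} [MeasurableSpace E] (μ : Measure E) (γ : ℝ) : Prop :=
  γ ∈ Set.Icc (0 : ℝ) 1 ∧ IsRegularlyVarying (fun t => (atomCount μ t : ℝ)) γ

/-- `N_n(x)`: the number of visits to `x` among the first `n` terms `s 0, …, s (n - 1)`. -/
def visits {E : Type*} (s : ℕ → E) (n : ℕ) (x : E) : ℕ :=
  {i : ℕ | i < n ∧ s i = x}.ncard

/-- `R_n`: the number of distinct elements among the first `n` terms `s 0, …, s (n - 1)`. -/
def rangeCard {E : Type*} (s : ℕ → E) (n : ℕ) : ℕ :=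
  {x : E | ∃ i < n, s i = x}.ncard

/-- `R_{n,k}`, for `k ≥ 1`: the number of points visited exactly `k` times among the first
`n` terms. -/
def rangeEq {E : Type*} (s : ℕ → E) (n k : ℕ) : ℕ :=
  {x : E | visits s n x = k}.ncard

/-- `R_{n,k+}`, for `k ≥ 1`: the number of points visited at least `k` times among the first
`n` terms. -/
def rangeGe {E : Type*} (s : ℕ → E) (n k : ℕ) : ℕ :=
  {x : E | k ≤ visits s n x}.ncard

/-- `r_k(γ) = γ Γ(k - γ) / (k! Γ(1 - γ))`. -/
def rCoeff (k : ℕ) (γ : ℝ) : ℝ :=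
  γ * Real.Gamma (k - γ) / (k.factorial * Real.Gamma (1 - γ))

end RangeRenewal

end

/-! Let A(t) count the points of π-mass at least 1/t. It inherits regular variation with index γ
from its analogue for the conditional law, because normalising by π(Δ) only rescales t. By Fubini a
value drawn twice is almost surely an atom, so for k ≥ 1 the number of points visited at least k + 1
times equals the number of such atoms (`atomGe`).

Mean: the tail P(Bin(n + 1, p) ≥ k + 1) is the integral over 0 < v ≤ np of a density converging to
the Poisson weight e^{-v} v^k / k!. Summing over atoms and exchanging sum and integral turns the
constraint v ≤ nπ{x} into A(n/v) (`integral_atomGe`). After division by A(n), regular variation and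
a Potter bound give the limit C_k = Γ(k + 1 - γ)/k! (`tendsto_integral_mul_binomDensity`).

Fluctuations: visit counts of distinct points are negatively correlated, so the variance is at most
the mean. Second moments are then summable along the times when the mean passes m², and monotonicity
fills the gaps (`ae_tendsto_div_integral_of_variance_le`). Hence the count divided by A(n) tends
almost surely to C_k.

The ratios for k ≥ 2 follow from C_{k+1} = C_k (1 - γ/(k + 1)). The linear growth comes from the
strong law: draws outside Δ are pairwise distinct, and atoms contribute only o(n) distinct values.
-/

noncomputable section

namespace RangeRenewal

/-! ### Regular variation -/

/-- A Potter-type bound with exponent `3 / 2`. -/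
theorem IsRegularlyVarying.exists_le_rpow {f : ℝ → ℝ} {γ : ℝ} (hγ : γ ≤ 1)
    (h : IsRegularlyVarying f γ) (hmono : MonotoneOn f (Set.Ioi 0))
    (hpos : ∀ᶠ t in atTop, 0 < f t) :
    ∃ T > 0, ∀ t ≥ T, ∀ s ≥ 1, f (s * t) ≤ 3 * s ^ (3 / 2 : ℝ) * f t := by
  -- The exponent must exceed every admissible γ ≤ 1, yet stay below 2 so that v^(k - 3/2) is
  -- integrable at 0 already for k = 1. The constant 3 absorbs 2^(3/2), the cost of rounding s up to
  -- a power of 2.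
  have h2 : (2 : ℝ) ^ γ < 2 ^ (3 / 2 : ℝ) :=
    Real.rpow_lt_rpow_of_exponent_lt (by norm_num) (by linarith)
  have h3 : (2 : ℝ) ^ (3 / 2 : ℝ) ≤ 3 := by
    have : ((2 : ℝ) ^ (3 / 2 : ℝ)) ^ 2 = 8 := by
      rw [← Real.rpow_natCast, ← Real.rpow_mul (by norm_num)]; norm_num
    nlinarith [Real.rpow_pos_of_pos (show (0 : ℝ) < 2 by norm_num) (3 / 2 : ℝ)]
  obtain ⟨T, hT⟩ := eventually_atTop.1
    (((h 2 two_pos).eventually (gt_mem_nhds h2)).and (hpos.and (eventually_gt_atTop 0)))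
  refine ⟨T, (hT T le_rfl).2.2, fun t ht s hs => ?_⟩
  have hT0 := (hT T le_rfl).2.2
  have ht0 : 0 < t := hT0.trans_le ht
  have step : ∀ t ≥ T, f (2 * t) ≤ 2 ^ (3 / 2 : ℝ) * f t := fun t ht =>
    ((div_lt_iff₀ (hT t ht).2.1).1 (hT t ht).1).le
  have iter : ∀ m : ℕ, f (2 ^ m * t) ≤ (2 ^ m : ℝ) ^ (3 / 2 : ℝ) * f t := by
    intro m
    induction m with
    | zero => simp
    | succ m ih =>
      have hm : T ≤ 2 ^ m * t := ht.trans (le_mul_of_one_le_left ht0.le (one_le_pow₀ (by norm_num)))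
      calc f (2 ^ (m + 1) * t) = f (2 * (2 ^ m * t)) := by ring_nf
        _ ≤ 2 ^ (3 / 2 : ℝ) * f (2 ^ m * t) := step _ hm
        _ ≤ 2 ^ (3 / 2 : ℝ) * ((2 ^ m : ℝ) ^ (3 / 2 : ℝ) * f t) := by gcongr
        _ = _ := by rw [pow_succ, Real.mul_rpow (by positivity) (by norm_num)]; ring
  obtain ⟨m, hm1, hm2⟩ := exists_nat_pow_near hs (show (1 : ℝ) < 2 by norm_num)
  have hft : 0 < f t := (hT t ht).2.1
  calc f (s * t) ≤ f (2 ^ (m + 1) * t) := by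
        apply hmono (Set.mem_Ioi.2 (by positivity)) (Set.mem_Ioi.2 (by positivity))
        gcongr
    _ ≤ (2 ^ (m + 1) : ℝ) ^ (3 / 2 : ℝ) * f t := iter _
    _ = 2 ^ (3 / 2 : ℝ) * (2 ^ m : ℝ) ^ (3 / 2 : ℝ) * f t := by
        rw [pow_succ, Real.mul_rpow (by positivity) (by norm_num)]; ring
    _ ≤ 3 * s ^ (3 / 2 : ℝ) * f t := by gcongr

/-! ### Binomial tails and their Poisson limit -/

/-- The probability that a binomial variable with parameters `n`, `p` is at least `k`. -/
def binomTail : ℕ → ℕ → ℝ → ℝ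
  | _, 0, _ => 1
  | 0, _ + 1, _ => 0
  | n + 1, k + 1, p => p * binomTail n k p + (1 - p) * binomTail n (k + 1) p

@[simp] theorem binomTail_zero_right (n : ℕ) (p : ℝ) : binomTail n 0 p = 1 := by
  cases n <;> rfl

@[simp] theorem binomTail_zero_succ (k : ℕ) (p : ℝ) : binomTail 0 (k + 1) p = 0 := rfl

theorem binomTail_succ (n k : ℕ) (p : ℝ) :
    binomTail (n + 1) k p = p * binomTail n (k - 1) p + (1 - p) * binomTail n k p := by
  cases k with
  | zero => simp
  | succ k => rfl

theorem binomTail_succ_at_zero (n k : ℕ) : binomTail n (k + 1) 0 = 0 := by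
  induction n with
  | zero => rfl
  | succ n ih => simp [binomTail_succ, ih]

theorem binomTail_sub (n k : ℕ) (p : ℝ) :
    binomTail n k p - binomTail n (k + 1) p = (bernsteinPolynomial ℝ n k).eval p := by
  have e : ∀ n k : ℕ, (bernsteinPolynomial ℝ n k).eval p = n.choose k * p ^ k * (1 - p) ^ (n - k) := by
    intro n k; simp [bernsteinPolynomial]
  rw [e]
  induction n generalizing k with
  | zero => cases k <;> simp
  | succ n ih =>
    cases k with
    | zero =>
      have := ih 0
      simp only [binomTail_succ] at this ⊢
      simp at this ⊢
      rw [pow_succ, ← this]; ring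
    | succ k =>
      have h1 := ih k
      have h2 := ih (k + 1)
      have : (n.choose (k + 1) : ℝ) * (1 - p) ^ (n - k) =
          n.choose (k + 1) * ((1 - p) * (1 - p) ^ (n - (k + 1))) := by
        rcases lt_or_ge k n with hk | hk
        · rw [← pow_succ', show n - (k + 1) + 1 = n - k by omega]
        · rw [Nat.choose_eq_zero_of_lt (by omega)]; simp
      simp only [binomTail_succ n, Nat.add_sub_cancel]
      rw [Nat.choose_succ_succ, Nat.add_sub_add_right]
      push_cast
      linear_combination p * h1 + (1 - p) * h2 - p ^ (k + 1) * this

/-- Consecutive tails differ by a Bernstein polynomial, whose derivative is a difference of two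
Bernstein polynomials of one degree less; the sum telescopes to a single term. -/
theorem hasDerivAt_binomTail (n k : ℕ) (p : ℝ) :
    HasDerivAt (binomTail (n + 1) (k + 1))
      ((n + 1) * (n.choose k * p ^ k * (1 - p) ^ (n - k))) p := by
  have e : (n.choose k * p ^ k * (1 - p) ^ (n - k) : ℝ) = (bernsteinPolynomial ℝ n k).eval p := by
    simp [bernsteinPolynomial]
  rw [e]
  clear e
  have hs : ∀ k, binomTail (n + 1) (k + 1) =
      fun p => binomTail (n + 1) k p - (bernsteinPolynomial ℝ (n + 1) k).eval p := by
    intro k; ext p; rw [← binomTail_sub]; ring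
  induction k with
  | zero =>
    rw [hs]
    simp only [binomTail_zero_right]
    refine (((bernsteinPolynomial ℝ (n + 1) 0).hasDerivAt p).const_sub 1).congr_deriv ?_
    simp [bernsteinPolynomial.derivative_zero]
    ring
  | succ k ih =>
    rw [hs]
    refine (ih.sub ((bernsteinPolynomial ℝ (n + 1) (k + 1)).hasDerivAt p)).congr_deriv ?_
    simp [bernsteinPolynomial.derivative_succ]
    ring

/-- The derivative of `v ↦ P (Bin (n + 1, v / n) ≥ k + 1)`. -/
def binomDensity (n k : ℕ) (v : ℝ) : ℝ :=
  (n + 1) / n * (n.choose k * (v / n) ^ k * (1 - v / n) ^ (n - k))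

theorem continuous_binomDensity (n k : ℕ) : Continuous (binomDensity n k) := by
  unfold binomDensity; fun_prop

theorem binomDensity_nonneg {n k : ℕ} {v : ℝ} (h0 : 0 ≤ v) (h1 : v ≤ n) :
    0 ≤ binomDensity n k v := by
  have : 0 ≤ 1 - v / n := sub_nonneg.2 (div_le_one_of_le₀ h1 (by positivity))
  unfold binomDensity; positivity

/-- Fundamental theorem of calculus, the tail vanishing at p = 0. The parameter p enters only
through the endpoint, which is what later lets the sum over atoms become a counting function. -/
theorem integral_binomDensity {n : ℕ} (hn : n ≠ 0) (k : ℕ) (p : ℝ) :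
    ∫ v in (0 : ℝ)..(n * p), binomDensity n k v = binomTail (n + 1) (k + 1) p := by
  have hn' : (n : ℝ) ≠ 0 := by exact_mod_cast hn
  have hd : ∀ v : ℝ, HasDerivAt (fun v => binomTail (n + 1) (k + 1) (v / n)) (binomDensity n k v) v := by
    intro v
    refine ((hasDerivAt_binomTail n k (v / n)).comp v
      ((hasDerivAt_id v).div_const (n : ℝ))).congr_deriv ?_
    unfold binomDensity; ring
  rw [intervalIntegral.integral_eq_sub_of_hasDerivAt (fun v _ => hd v)
    ((continuous_binomDensity n k).intervalIntegrable _ _)]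
  simp [binomTail_succ_at_zero, mul_div_cancel_left₀ _ hn']

theorem tendsto_binomDensity (k : ℕ) (v : ℝ) :
    Tendsto (fun n => binomDensity n k v) atTop (𝓝 (Real.exp (-v) * v ^ k / k.factorial)) := by
  have h1 : Tendsto (fun n : ℕ => ((n : ℝ) + 1) / n) atTop (𝓝 1) := by
    have := tendsto_one_div_atTop_nhds_zero_nat (𝕜 := ℝ)
    have := this.const_add 1
    rw [add_zero] at this
    refine this.congr' ?_
    filter_upwards [eventually_gt_atTop 0] with n hn
    field_simp
  have h2 : Tendsto (fun n : ℕ => (n : ℝ) * (v / n)) atTop (𝓝 v) := by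
    refine tendsto_const_nhds.congr' ?_
    filter_upwards [eventually_gt_atTop 0] with n hn
    field_simp
  have := h1.mul (tendsto_choose_mul_pow_of_tendsto_mul_atTop k h2)
  rwa [one_mul] at this

/-- A majorant uniform in n: 1 - x ≤ e^{-x}, and n - k ≥ n/2 leaves half of the exponential decay.
-/
theorem binomDensity_le {n k : ℕ} (hn : 0 < n) (hk : 2 * k ≤ n) {v : ℝ} (h0 : 0 ≤ v) (h1 : v ≤ n) :
    binomDensity n k v ≤ 2 * (v ^ k * Real.exp (-(v / 2))) := by
  have hn' : (1 : ℝ) ≤ n := by exact_mod_cast hn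
  have a : ((n : ℝ) + 1) / n ≤ 2 := by rw [div_le_iff₀ (by linarith)]; linarith
  have hx : 0 ≤ 1 - v / n := sub_nonneg.2 (div_le_one_of_le₀ h1 (by positivity))
  have b : (n.choose k : ℝ) * (v / n) ^ k ≤ v ^ k := by
    have : (n.choose k : ℝ) ≤ n ^ k := by exact_mod_cast Nat.choose_le_pow n k
    calc (n.choose k : ℝ) * (v / n) ^ k ≤ n ^ k * (v / n) ^ k := by gcongr
      _ = v ^ k := by rw [← mul_pow]; congr 1; field_simp
  have c : (1 - v / n) ^ (n - k) ≤ Real.exp (-(v / 2)) := by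
    calc (1 - v / n) ^ (n - k) ≤ Real.exp (-(v / n)) ^ (n - k) := by
          gcongr; exact Real.one_sub_le_exp_neg _
      _ = Real.exp (-(v / n * ((n - k : ℕ) : ℝ))) := by rw [← Real.exp_nat_mul]; ring_nf
      _ ≤ _ := by
        apply Real.exp_le_exp.2
        have : (n : ℝ) / 2 ≤ ((n - k : ℕ) : ℝ) := by
          rw [div_le_iff₀ two_pos]; norm_cast; omega
        have h3 : v / n * (n / 2) ≤ v / n * ((n - k : ℕ) : ℝ) := by gcongr
        have h4 : v / n * (n / 2) = v / 2 := by field_simp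
        linarith
  unfold binomDensity
  gcongr

/-! ### Asymptotics of the mean -/

theorem integral_gamma_density {γ : ℝ} {k : ℕ} (h : γ < k + 1) :
    ∫ v in Set.Ioi (0 : ℝ), v ^ (-γ) * (Real.exp (-v) * v ^ k / k.factorial) =
      Real.Gamma (k + 1 - γ) / k.factorial := by
  rw [Real.Gamma_eq_integral (by linarith), ← integral_div]
  refine setIntegral_congr_fun measurableSet_Ioi fun v hv => ?_
  have hv : 0 < v := hv
  have : v ^ ((k : ℝ) + 1 - γ - 1) = v ^ (-γ) * v ^ k := by
    rw [← Real.rpow_natCast, ← Real.rpow_add hv]; congr 1; ring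
  simp only [this]; ring

theorem aestronglyMeasurable_mul_binomDensity {f : ℝ → ℝ} (hmono : MonotoneOn f (Set.Ioi 0))
    (n k : ℕ) : AEStronglyMeasurable (fun v => f (n / v) * binomDensity n k v)
      (volume.restrict (Set.Ioi (0 : ℝ))) := by
  rcases Nat.eq_zero_or_pos n with rfl | hn
  · simp only [Nat.cast_zero, zero_div]
    exact ((continuous_binomDensity 0 k).const_mul _).aestronglyMeasurable
  have : AntitoneOn (fun v => f (n / v)) (Set.Ioi (0 : ℝ)) := by
    intro a ha b hb hab
    have ha : 0 < a := ha
    have hb : 0 < b := hb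
    apply hmono (Set.mem_Ioi.2 (by positivity)) (Set.mem_Ioi.2 (by positivity))
    gcongr
  have h1 : AEMeasurable (fun v => f (n / v)) (volume.restrict (Set.Ioi (0 : ℝ))) :=
    aemeasurable_restrict_of_antitoneOn measurableSet_Ioi this
  exact (h1.mul (continuous_binomDensity n k).measurable.aemeasurable).aestronglyMeasurable

/-- The limit of the expected number of atoms visited at least `k + 1` times, relative to the
counting function. -/
theorem tendsto_integral_mul_binomDensity {f : ℝ → ℝ} {γ : ℝ} (hγ : γ ∈ Set.Icc (0 : ℝ) 1)
    (h : IsRegularlyVarying f γ) (hmono : MonotoneOn f (Set.Ioi 0)) (h0 : ∀ t, 0 ≤ f t)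
    (hpos : ∀ᶠ t in atTop, 0 < f t) (hlt : ∀ t, 0 < t → t < 1 → f t = 0) {k : ℕ} (hk : 1 ≤ k) :
    Tendsto (fun n : ℕ => (∫ v in Set.Ioi (0 : ℝ), f (n / v) * binomDensity n k v) / f n) atTop
      (𝓝 (Real.Gamma (k + 1 - γ) / k.factorial)) := by
  obtain ⟨T, hT0, hT⟩ := h.exists_le_rpow hγ.2 hmono hpos
  have hk' : (1 : ℝ) ≤ k := by exact_mod_cast hk
  rw [← integral_gamma_density (show γ < (k : ℝ) + 1 by linarith [hγ.2])]
  simp_rw [← integral_div]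
  have hcast := tendsto_natCast_atTop_atTop (R := ℝ)
  refine tendsto_integral_filter_of_dominated_convergence
    (fun v => 6 * (v ^ (k : ℝ) * Real.exp (-(1 / 2) * v ^ (1 : ℝ))
      + v ^ ((k : ℝ) - 3 / 2) * Real.exp (-(1 / 2) * v ^ (1 : ℝ))))
    (Eventually.of_forall fun n =>
      ((aestronglyMeasurable_mul_binomDensity hmono n k).aemeasurable.div_const _).aestronglyMeasurable) ?_ ?_ ?_
  · filter_upwards [hcast.eventually_ge_atTop T, hcast.eventually hpos,
      eventually_ge_atTop (2 * k), eventually_gt_atTop 0] with n hnT hfn hnk hn0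
    filter_upwards [ae_restrict_mem measurableSet_Ioi] with v hv
    have hv : 0 < v := hv
    have hn0' : (0 : ℝ) < n := by exact_mod_cast hn0
    have hexp : Real.exp (-(1 / 2) * v ^ (1 : ℝ)) = Real.exp (-(v / 2)) := by
      rw [Real.rpow_one]; ring_nf
    rw [hexp]
    -- For v > n the density may be negative, but f(n/v) = 0 there since n/v < 1.
    rcases lt_or_ge (n : ℝ) v with hvn | hvn
    · rw [hlt (n / v) (by positivity) ((div_lt_one hv).2 hvn)]
      simp only [zero_mul, zero_div, norm_zero]
      positivity
    have hg0 := binomDensity_nonneg (k := k) hv.le hvn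
    rw [Real.norm_of_nonneg (div_nonneg (mul_nonneg (h0 _) hg0) hfn.le)]
    have hg := binomDensity_le hn0 hnk hv.le hvn
    -- Monotonicity covers v ≥ 1, the Potter bound with s = 1/v covers v ≤ 1; the sum of both bounds
    -- serves everywhere.
    have hf : f (n / v) ≤ 3 * (1 + v ^ (-(3 / 2) : ℝ)) * f n := by
      rcases le_total 1 v with h1 | h1
      · have : f (n / v) ≤ f n :=
          hmono (Set.mem_Ioi.2 (by positivity)) hn0' (div_le_self hn0'.le h1)
        have := Real.rpow_pos_of_pos hv (-(3 / 2))
        nlinarith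
      · have := hT n hnT v⁻¹ ((one_le_inv₀ hv).2 h1)
        rw [Real.inv_rpow hv.le, ← Real.rpow_neg hv.le, inv_mul_eq_div] at this
        nlinarith
    rw [div_le_iff₀ hfn]
    calc f (n / v) * binomDensity n k v
        ≤ (3 * (1 + v ^ (-(3 / 2) : ℝ)) * f n) * (2 * (v ^ k * Real.exp (-(v / 2)))) := by
          gcongr
      _ = _ := by rw [sub_eq_add_neg, Real.rpow_add hv, Real.rpow_natCast]; ring
  · exact ((integrableOn_rpow_mul_exp_neg_mul_rpow (by linarith) one_pos (by norm_num)).add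
      (integrableOn_rpow_mul_exp_neg_mul_rpow (by linarith) one_pos (by norm_num))).const_mul 6
  · filter_upwards [ae_restrict_mem measurableSet_Ioi] with v hv
    have hv : 0 < v := hv
    have h1 := (h v⁻¹ (inv_pos.2 hv)).comp hcast
    rw [Real.inv_rpow hv.le, ← Real.rpow_neg hv.le] at h1
    refine (h1.mul (tendsto_binomDensity k v)).congr fun n => ?_
    simp only [Function.comp_apply, inv_mul_eq_div]
    ring

/-! ### Almost sure convergence from a variance bound -/

/-- Sandwich argument: a monotone sequence is asymptotic to `M` if it is so along the times at which
`M` passes the squares. -/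
theorem tendsto_div_of_tendsto_along_squares {x M : ℕ → ℝ} {τ : ℕ → ℕ} (hx : Monotone x)
    (hx0 : ∀ n, 0 ≤ x n) (hM : Tendsto M atTop atTop) (hle : ∀ m n : ℕ, (m : ℝ) ^ 2 ≤ M n → τ m ≤ n)
    (hge : ∀ m n : ℕ, M n < (m : ℝ) ^ 2 → n ≤ τ m)
    (h : Tendsto (fun m : ℕ => x (τ m) / (m : ℝ) ^ 2) atTop (𝓝 1)) :
    Tendsto (fun n => x n / M n) atTop (𝓝 1) := by
  have hr : Tendsto (fun m : ℕ => ((m : ℝ) / (m + 1)) ^ 2) atTop (𝓝 1) := by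
    simpa using (tendsto_natCast_div_add_atTop (1 : ℝ)).pow 2
  have lo : Tendsto (fun m : ℕ => x (τ m) / ((m : ℝ) + 1) ^ 2) atTop (𝓝 1) := by
    have := h.mul hr
    rw [one_mul] at this
    refine this.congr' ?_
    filter_upwards [eventually_gt_atTop 0] with m hm
    field_simp
  have hi : Tendsto (fun m : ℕ => x (τ (m + 1)) / (m : ℝ) ^ 2) atTop (𝓝 1) := by
    have := ((tendsto_add_atTop_iff_nat 1).2 h).mul (hr.inv₀ one_ne_zero)
    rw [inv_one, one_mul] at this
    refine this.congr' ?_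
    filter_upwards [eventually_gt_atTop 0] with m hm
    push_cast
    field_simp
  -- Chosen so that s(n)² ≤ M n < (s(n) + 1)² once M n ≥ 0; thus n lies between τ(s(n)) and τ(s(n) +
  -- 1), and consecutive squares have ratio tending to 1.
  set s : ℕ → ℕ := fun n => Nat.sqrt ⌊M n⌋₊
  have hs : Tendsto s atTop atTop := by
    refine tendsto_atTop.2 fun b => ?_
    filter_upwards [hM.eventually_ge_atTop ((b * b : ℕ) : ℝ)] with n hn
    exact Nat.le_sqrt.2 (Nat.le_floor hn)
  refine tendsto_of_tendsto_of_tendsto_of_le_of_le' (lo.comp hs) (hi.comp hs) ?_ ?_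
  all_goals
    filter_upwards [hM.eventually_ge_atTop 1, hs.eventually_gt_atTop 0] with n hn hsn
    have h1 : (s n : ℝ) ^ 2 ≤ M n := by
      have : s n ^ 2 ≤ ⌊M n⌋₊ := Nat.sqrt_le' _
      exact le_trans (by exact_mod_cast this) (Nat.floor_le (by linarith))
    have h2 : M n < ((s n : ℝ) + 1) ^ 2 := by
      have : ⌊M n⌋₊ + 1 ≤ (s n + 1) ^ 2 := Nat.lt_succ_sqrt' _
      exact (Nat.lt_floor_add_one _).trans_le (by exact_mod_cast this)
    have h3 : (0 : ℝ) < s n := by exact_mod_cast hsn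
    simp only [Function.comp_apply]
  · exact div_le_div₀ (hx0 _) (hx (hle _ _ h1)) (by linarith) h2.le
  · exact div_le_div₀ (hx0 _) (hx (hge (s n + 1) _ (by exact_mod_cast h2))) (by positivity) h1

/-- The usual Chebyshev and subsequence argument. Increments of at most 1 prevent the mean from
overshooting a square by more than 1, so no growth rate for the mean is needed. -/
theorem ae_tendsto_div_integral_of_variance_le {Ω : Type*} [MeasurableSpace Ω] {P : Measure Ω}
    [IsProbabilityMeasure P] {X : ℕ → Ω → ℝ} (hmeas : ∀ n, Measurable (X n))
    (hmono : ∀ ω, Monotone fun n => X n ω) (hzero : ∀ ω, X 0 ω = 0)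
    (hinc : ∀ n ω, X (n + 1) ω ≤ X n ω + 1) (hvar : ∀ n, Var[X n; P] ≤ ∫ ω, X n ω ∂P)
    (hlim : Tendsto (fun n => ∫ ω, X n ω ∂P) atTop atTop) :
    ∀ᵐ ω ∂P, Tendsto (fun n => X n ω / ∫ ω, X n ω ∂P) atTop (𝓝 1) := by
  have hnonneg : ∀ n ω, 0 ≤ X n ω := fun n ω => hzero ω ▸ hmono ω (Nat.zero_le n)
  have hle : ∀ n ω, X n ω ≤ n := by
    intro n ω
    induction n with
    | zero => simp [hzero]
    | succ n ih => push_cast; linarith [hinc n ω]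
  have hLp : ∀ n, MemLp (X n) 2 P := fun n =>
    MemLp.of_bound (hmeas n).aestronglyMeasurable n
      (Eventually.of_forall fun ω => by
        rw [Real.norm_of_nonneg (hnonneg n ω)]; exact hle n ω)
  have hint : ∀ n, Integrable (X n) P := fun n => (hLp n).integrable (by norm_num)
  set M : ℕ → ℝ := fun n => ∫ ω, X n ω ∂P
  have hMmono : Monotone M := fun a b hab =>
    integral_mono (hint a) (hint b) fun ω => hmono ω hab
  have hMinc : ∀ n, M (n + 1) ≤ M n + 1 := by
    intro n
    have := integral_mono (hint (n + 1)) ((hint n).add (integrable_const 1)) (hinc n)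
    simpa [integral_add (hint n) (integrable_const 1)] using this
  have hM0 : M 0 = 0 := by simp [M, hzero]
  have hex : ∀ m : ℕ, ∃ n, (m : ℝ) ^ 2 ≤ M n := fun m =>
    (hlim.eventually_ge_atTop ((m : ℝ) ^ 2)).exists
  classical
  -- The first time the mean reaches m²; there it lies between m² and m² + 1.
  set τ : ℕ → ℕ := fun m => Nat.find (hex m)
  have hτ1 : ∀ m : ℕ, (m : ℝ) ^ 2 ≤ M (τ m) := fun m => Nat.find_spec (hex m)
  have hτ2 : ∀ m, M (τ m) ≤ (m : ℝ) ^ 2 + 1 := by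
    intro m
    rcases h : τ m with _ | j
    · rw [hM0]; positivity
    · have : ¬ (m : ℝ) ^ 2 ≤ M j := Nat.find_min (hex m) (by change j < τ m; omega)
      linarith [hMinc j]
  have hτlim : Tendsto (fun m : ℕ => M (τ m) / (m : ℝ) ^ 2) atTop (𝓝 1) := by
    have h1 : Tendsto (fun m : ℕ => 1 + 1 / (m : ℝ) ^ 2) atTop (𝓝 1) := by
      have : Tendsto (fun m : ℕ => (1 / (m : ℝ)) ^ 2) atTop (𝓝 0) := by
        simpa using (tendsto_one_div_atTop_nhds_zero_nat (𝕜 := ℝ)).pow 2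
      simpa [one_div] using this.const_add 1
    refine tendsto_of_tendsto_of_tendsto_of_le_of_le' tendsto_const_nhds h1 ?_ ?_
    all_goals
      filter_upwards [eventually_gt_atTop 0] with m hm
      have hm : (0 : ℝ) < (m : ℝ) ^ 2 := by positivity
    · rw [le_div_iff₀ hm]; linarith [hτ1 m]
    · rw [div_le_iff₀ hm, add_mul, one_div, inv_mul_cancel₀ hm.ne']; linarith [hτ2 m]
  set Y : ℕ → Ω → ℝ := fun m ω => ((X (τ m) ω - M (τ m)) / (m : ℝ) ^ 2) ^ 2
  have hYint : ∀ m, Integrable (Y m) P := fun m =>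
    (((hLp (τ m)).sub (memLp_const (M (τ m)))).integrable_sq.div_const (((m : ℝ) ^ 2) ^ 2)).congr
      (Eventually.of_forall fun ω => by simp [Y, div_pow])
  -- The variance is at most the mean, hence at most m² + 1 ≤ 2m² for m ≥ 1; division by m⁴ gives
  -- 2/m². At m = 0 both sides vanish by the convention for division by zero.
  have hY : ∀ m, ∫ ω, Y m ω ∂P ≤ 2 * (1 / (m : ℝ) ^ 2) := by
    intro m
    have e : ∫ ω, Y m ω ∂P = Var[X (τ m); P] / ((m : ℝ) ^ 2) ^ 2 := by
      rw [variance_eq_integral (hmeas _).aemeasurable, ← integral_div]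
      simp only [Y, div_pow, M]
    rw [e]
    rcases Nat.eq_zero_or_pos m with rfl | hm
    · simp
    have hm1 : (1 : ℝ) ≤ (m : ℝ) ^ 2 := one_le_pow₀ (by exact_mod_cast hm)
    rw [div_le_iff₀ (by positivity)]
    have : 2 * (1 / (m : ℝ) ^ 2) * ((m : ℝ) ^ 2) ^ 2 = 2 * (m : ℝ) ^ 2 := by field_simp
    rw [this]
    linarith [hvar (τ m), hτ2 m]
  -- In place of Borel–Cantelli: the sum of the Y m has finite expectation, so it is almost surely
  -- finite and its terms tend to 0.
  have hsum : ∑' m, ∫⁻ ω, ENNReal.ofReal (Y m ω) ∂P ≠ ⊤ := by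
    have hs : Summable fun m : ℕ => 2 * (1 / (m : ℝ) ^ 2) :=
      (Real.summable_one_div_nat_pow.2 one_lt_two).mul_left 2
    refine ne_top_of_le_ne_top hs.tsum_ofReal_ne_top (ENNReal.tsum_le_tsum fun m => ?_)
    rw [← ofReal_integral_eq_lintegral_ofReal (hYint m)
      (Eventually.of_forall fun ω => sq_nonneg _)]
    exact ENNReal.ofReal_le_ofReal (hY m)
  have hYmeas : ∀ m, Measurable fun ω => ENNReal.ofReal (Y m ω) := fun m =>
    ((((hmeas _).sub_const _).div_const _).pow_const 2).ennreal_ofReal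
  rw [← lintegral_tsum fun m => (hYmeas m).aemeasurable] at hsum
  filter_upwards [ae_lt_top (Measurable.tsum hYmeas) hsum] with ω hω
  have hY0 : Tendsto (fun m => Y m ω) atTop (𝓝 0) := by
    have := ENNReal.tendsto_atTop_zero_of_tsum_ne_top hω.ne
    have := (ENNReal.tendsto_toReal ENNReal.zero_ne_top).comp this
    simpa [Function.comp_def, Y, ENNReal.toReal_ofReal, sq_nonneg] using this
  have h0 : Tendsto (fun m : ℕ => (X (τ m) ω - M (τ m)) / (m : ℝ) ^ 2) atTop (𝓝 0) := by
    have := hY0.sqrt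
    simp only [Y, Real.sqrt_sq_eq_abs, Real.sqrt_zero] at this
    exact (tendsto_zero_iff_abs_tendsto_zero _).2 this
  refine tendsto_div_of_tendsto_along_squares (hmono ω) (fun n => hnonneg n ω) hlim
    (τ := τ) (fun m n h => Nat.find_min' (hex m) h) (fun m n h => ?_) ?_
  · by_contra! hc
    exact absurd (hτ1 m) (not_le.2 ((hMmono hc.le).trans_lt h))
  · have := h0.add hτlim
    rw [zero_add] at this
    refine this.congr fun m => ?_
    ring

/-! ### Visit counts along a sequence -/

section Visits

variable {E : Type*} (s : ℕ → E)

open Classical in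
theorem visits_eq_sum (n : ℕ) (x : E) :
    visits s n x = ∑ i ∈ Finset.range n, if s i = x then 1 else 0 := by
  rw [← Finset.card_filter, visits, ← Set.ncard_coe_finset]
  congr 1
  ext i
  simp

@[simp] theorem visits_zero (x : E) : visits s 0 x = 0 := by
  simp [visits]

open Classical in
theorem visits_succ (n : ℕ) (x : E) :
    visits s (n + 1) x = visits s n x + if s n = x then 1 else 0 := by
  rw [visits_eq_sum, visits_eq_sum, Finset.sum_range_succ]

theorem visits_mono (x : E) : Monotone fun n => visits s n x := by
  classical
  refine monotone_nat_of_le_succ fun n => ?_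
  rw [visits_succ]
  exact Nat.le_add_right _ _

theorem one_le_visits_iff (n : ℕ) (x : E) : 1 ≤ visits s n x ↔ ∃ i < n, s i = x := by
  exact Nat.one_le_iff_ne_zero.trans Nat.pos_iff_ne_zero.symm |>.trans
    (Set.ncard_pos ((Set.finite_lt_nat n).subset fun i hi => hi.1))

theorem finite_le_visits (n : ℕ) {k : ℕ} (hk : 1 ≤ k) : {x | k ≤ visits s n x}.Finite := by
  refine ((Set.finite_lt_nat n).image s).subset fun x hx => ?_
  obtain ⟨i, hi, h⟩ := (one_le_visits_iff s n x).1 (hk.trans hx)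
  exact ⟨i, hi, h⟩

end Visits

/-! ### Law and negative correlation of visit counts -/

section Probability

variable {E : Type*} [MeasurableSpace E] {Ω : Type*} [MeasurableSpace Ω] {P : Measure Ω}
  {π : Measure E} {ξ : ℕ → Ω → E}

theorem measurableSet_singleton_of_measurableEq [MeasurableEq E] (x : E) :
    MeasurableSet ({x} : Set E) :=
  measurableSet_eq_fun measurable_id measurable_const

variable [MeasurableEq E]

theorem measurable_visits (hmeas : ∀ i, Measurable (ξ i)) (n : ℕ) (x : E) :
    Measurable fun ω => visits (fun i => ξ i ω) n x := by
  classical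
  simp_rw [visits_eq_sum]
  exact Finset.measurable_sum _ fun i _ => Measurable.ite
    (hmeas i (measurableSet_singleton_of_measurableEq x)) measurable_const measurable_const

theorem measurableSet_le_visits (hmeas : ∀ i, Measurable (ξ i)) (n a : ℕ) (x : E) :
    MeasurableSet {ω | a ≤ visits (fun i => ξ i ω) n x} :=
  measurableSet_le measurable_const (measurable_visits hmeas n x)

theorem indepFun_visits (hmeas : ∀ i, Measurable (ξ i)) (hindep : iIndepFun ξ P) (n : ℕ)
    (x y : E) :
    IndepFun (fun ω => (visits (fun i => ξ i ω) n x, visits (fun i => ξ i ω) n y)) (ξ n) P := by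
  classical
  have h := hindep.indepFun_finset (Finset.range n) {n} (by simp) hmeas
  let φ : E → (Finset.range n → E) → ℕ := fun x t => ∑ i, if t i = x then 1 else 0
  have hφ : ∀ x, Measurable (φ x) := fun x =>
    Finset.measurable_sum _ fun i _ => Measurable.ite
      (measurableSet_eq_fun (measurable_pi_apply i) measurable_const)
      measurable_const measurable_const
  have e : ∀ x ω, φ x (fun i => ξ i ω) = visits (fun i => ξ i ω) n x := by
    intro x ω
    rw [visits_eq_sum]
    exact Finset.sum_coe_sort (Finset.range n) fun i => if ξ i ω = x then 1 else 0
  have := h.comp ((hφ x).prodMk (hφ y))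
    (measurable_pi_apply (⟨n, Finset.mem_singleton_self n⟩ : ({n} : Finset ℕ)))
  convert! this using 1
  ext ω <;> simp [e]

theorem measureReal_visits_inter (hmeas : ∀ i, Measurable (ξ i)) (hindep : iIndepFun ξ P)
    (hlaw : ∀ i, P.map (ξ i) = π) (n a b : ℕ) (x y : E) {B : Set E} (hB : MeasurableSet B) :
    P.real ({ω | a ≤ visits (fun i => ξ i ω) n x ∧ b ≤ visits (fun i => ξ i ω) n y} ∩ ξ n ⁻¹' B) =
      P.real {ω | a ≤ visits (fun i => ξ i ω) n x ∧ b ≤ visits (fun i => ξ i ω) n y} *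
        π.real B := by
  have h := (indepFun_visits hmeas hindep n x y).measure_inter_preimage_eq_mul
    {q : ℕ × ℕ | a ≤ q.1 ∧ b ≤ q.2} B (Set.to_countable _).measurableSet hB
  rw [← hlaw n, map_measureReal_apply (hmeas n) hB]
  simp only [Measure.real, ← ENNReal.toReal_mul]
  exact congrArg ENNReal.toReal h

variable [IsProbabilityMeasure P]

/-- Splitting on whether the last draw, independent of the past, equals x reproduces the recursion
defining `binomTail`. Truncated subtraction makes a = 0 consistent. -/
theorem measureReal_le_visits (hmeas : ∀ i, Measurable (ξ i)) (hindep : iIndepFun ξ P)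
    (hlaw : ∀ i, P.map (ξ i) = π) (n a : ℕ) (x : E) :
    P.real {ω | a ≤ visits (fun i => ξ i ω) n x} = binomTail n a (π.real {x}) := by
  classical
  have hx := measurableSet_singleton_of_measurableEq x
  have : IsProbabilityMeasure π := hlaw 0 ▸ Measure.isProbabilityMeasure_map (hmeas 0).aemeasurable
  induction n generalizing a with
  | zero => cases a <;> simp
  | succ n ih =>
    have key := fun a {B : Set E} (hB : MeasurableSet B) =>
      measureReal_visits_inter hmeas hindep hlaw n a 0 x x hB
    simp only [Nat.zero_le, and_true] at key
    have e : {ω | a ≤ visits (fun i => ξ i ω) (n + 1) x} =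
        ({ω | a - 1 ≤ visits (fun i => ξ i ω) n x} ∩ ξ n ⁻¹' {x}) ∪
        ({ω | a ≤ visits (fun i => ξ i ω) n x} ∩ ξ n ⁻¹' {x}ᶜ) := by
      ext ω
      by_cases h : ξ n ω = x <;> simp [visits_succ, h]
    rw [e, measureReal_union, key _ hx, key _ hx.compl, ih, ih, probReal_compl_eq_one_sub hx,
      binomTail_succ]
    · ring
    · exact Disjoint.inter_left' _ (Disjoint.inter_right' _
        (Disjoint.preimage _ disjoint_compl_right))
    · exact (measurableSet_le_visits hmeas n a x).inter (hmeas n hx.compl)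

/-- Multinomial counts are negatively correlated. -/
theorem measureReal_le_visits_and_le (hmeas : ∀ i, Measurable (ξ i)) (hindep : iIndepFun ξ P)
    (hlaw : ∀ i, P.map (ξ i) = π) (n a b : ℕ) {x y : E} (hxy : x ≠ y) :
    P.real {ω | a ≤ visits (fun i => ξ i ω) n x ∧ b ≤ visits (fun i => ξ i ω) n y} ≤
      P.real {ω | a ≤ visits (fun i => ξ i ω) n x} *
        P.real {ω | b ≤ visits (fun i => ξ i ω) n y} := by
  classical
  have hx := measurableSet_singleton_of_measurableEq x
  have hy := measurableSet_singleton_of_measurableEq y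
  have : IsProbabilityMeasure π := hlaw 0 ▸ Measure.isProbabilityMeasure_map (hmeas 0).aemeasurable
  induction n generalizing a b with
  | zero => cases a <;> cases b <;> simp
  | succ n ih =>
    have key := fun a b {B : Set E} (hB : MeasurableSet B) =>
      measureReal_visits_inter hmeas hindep hlaw n a b x y hB
    have hm : ∀ a b, MeasurableSet
        {ω | a ≤ visits (fun i => ξ i ω) n x ∧ b ≤ visits (fun i => ξ i ω) n y} := fun a b =>
      (measurableSet_le_visits hmeas n a x).inter (measurableSet_le_visits hmeas n b y)
    have hxy' : MeasurableSet ({x, y} : Set E) := hx.union hy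
    -- Split on the last draw: x, y, or neither. It cannot advance both counts, which is the source
    -- of the negative correlation.
    have e : {ω | a ≤ visits (fun i => ξ i ω) (n + 1) x ∧ b ≤ visits (fun i => ξ i ω) (n + 1) y} =
        ({ω | a - 1 ≤ visits (fun i => ξ i ω) n x ∧ b ≤ visits (fun i => ξ i ω) n y} ∩
          ξ n ⁻¹' {x}) ∪
        (({ω | a ≤ visits (fun i => ξ i ω) n x ∧ b - 1 ≤ visits (fun i => ξ i ω) n y} ∩
          ξ n ⁻¹' {y}) ∪
        ({ω | a ≤ visits (fun i => ξ i ω) n x ∧ b ≤ visits (fun i => ξ i ω) n y} ∩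
          ξ n ⁻¹' {x, y}ᶜ)) := by
      ext ω
      by_cases h : ξ n ω = x
      · have : ξ n ω ≠ y := h ▸ hxy
        simp [visits_succ, h, hxy]
      · by_cases h' : ξ n ω = y <;> simp [visits_succ, h, h', hxy.symm]
    have d1 : Disjoint ({x} : Set E) {y} := by simpa using hxy
    have d2 : Disjoint ({x} : Set E) {x, y}ᶜ := disjoint_compl_right.mono_left (by simp)
    have d3 : Disjoint ({y} : Set E) {x, y}ᶜ := disjoint_compl_right.mono_left (by simp)
    have dj : ∀ {A B : Set Ω} {S T : Set E}, Disjoint S T →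
        Disjoint (A ∩ ξ n ⁻¹' S) (B ∩ ξ n ⁻¹' T) := fun h =>
      Disjoint.inter_left' _ (Disjoint.inter_right' _ (Disjoint.preimage _ h))
    have hq : π.real ({x, y}ᶜ : Set E) = 1 - π.real {x} - π.real {y} := by
      rw [probReal_compl_eq_one_sub hxy', Set.insert_eq, measureReal_union d1 hy]; ring
    rw [e, measureReal_union (Disjoint.union_right (dj d1) (dj d2))
      (((hm _ _).inter (hmeas n hy)).union ((hm _ _).inter (hmeas n hxy'.compl))),
      measureReal_union (dj d3) ((hm _ _).inter (hmeas n hxy'.compl)),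
      key _ _ hx, key _ _ hy, key _ _ hxy'.compl, hq]
    have h1 := ih (a - 1) b
    have h2 := ih a (b - 1)
    have h3 := ih a b
    have mono : ∀ a (x : E), P.real {ω | a ≤ visits (fun i => ξ i ω) n x} ≤
        P.real {ω | a - 1 ≤ visits (fun i => ξ i ω) n x} := fun a x =>
      measureReal_mono fun ω hω => (Nat.sub_le a 1).trans hω
    have h4 := mono a x
    have h5 := mono b y
    rw [measureReal_le_visits hmeas hindep hlaw (n + 1), measureReal_le_visits hmeas hindep hlaw (n + 1),
      binomTail_succ, binomTail_succ]
    simp only [← measureReal_le_visits hmeas hindep hlaw n]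
    have hp : 0 ≤ π.real {x} := measureReal_nonneg
    have hq0 : 0 ≤ π.real {y} := measureReal_nonneg
    have hr : 0 ≤ 1 - π.real {x} - π.real {y} := hq ▸ measureReal_nonneg
    have t1 := mul_le_mul_of_nonneg_right h1 hp
    have t2 := mul_le_mul_of_nonneg_right h2 hq0
    have t3 := mul_le_mul_of_nonneg_right h3 hr
    -- With p, q the masses of x, y and F, G the tails at time n, the product at time n + 1 exceeds
    -- the bound from the induction hypothesis by exactly pq(F(a - 1) - F(a))(G(b - 1) - G(b)).
    have t4 := mul_nonneg (mul_nonneg hp hq0) (mul_nonneg (sub_nonneg.2 h4) (sub_nonneg.2 h5))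
    linarith

end Probability

theorem tsum_indicator_one_eq_ncard {E : Type*} {S T : Set E} (h : (S ∩ T).Finite) :
    ∑' x : S, T.indicator (1 : E → ENNReal) x = ((S ∩ T).ncard : ENNReal) := by
  rw [tsum_subtype S (T.indicator 1), Set.indicator_indicator, ← tsum_subtype (S ∩ T)]
  simp only [Pi.one_apply, ENNReal.tsum_one]
  rw [← Set.encard, ← h.cast_ncard_eq]
  simp

/-- The variance of a number of occurrences of negatively correlated events is at most its mean. -/
theorem variance_le_integral_of_negative_correlation {ι Ω : Type*} [Countable ι]
    [MeasurableSpace Ω] {P : Measure Ω} [IsProbabilityMeasure P] {A : ι → Set Ω}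
    (hA : ∀ i, MeasurableSet (A i)) (hneg : ∀ i j, i ≠ j → P (A i ∩ A j) ≤ P (A i) * P (A j))
    {X : Ω → ℝ} (hX0 : ∀ ω, 0 ≤ X ω) (hX : MemLp X 2 P)
    (h : ∀ ω, ENNReal.ofReal (X ω) = ∑' i, (A i).indicator 1 ω) :
    Var[X; P] ≤ ∫ ω, X ω ∂P := by
  classical
  have hmeas : ∀ i, Measurable ((A i).indicator (1 : Ω → ENNReal)) := fun i =>
    measurable_one.indicator (hA i)
  have h1 : ENNReal.ofReal (∫ ω, X ω ∂P) = ∑' i, P (A i) := by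
    rw [ofReal_integral_eq_lintegral_ofReal (hX.integrable (by norm_num))
      (Eventually.of_forall hX0)]
    simp_rw [h]
    rw [lintegral_tsum fun i => (hmeas i).aemeasurable]
    simp_rw [lintegral_indicator_one (hA _)]
  have h2 : ENNReal.ofReal (∫ ω, (X ^ 2) ω ∂P) = ∑' i, ∑' j, P (A i ∩ A j) := by
    simp_rw [Pi.pow_apply]
    rw [ofReal_integral_eq_lintegral_ofReal hX.integrable_sq
      (Eventually.of_forall fun ω => sq_nonneg _)]
    have e : ∀ ω, ENNReal.ofReal (X ω ^ 2) =
        ∑' i, ∑' j, (A i ∩ A j).indicator (1 : Ω → ENNReal) ω := by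
      intro ω
      simp_rw [Set.inter_indicator_one, Pi.mul_apply, ENNReal.tsum_mul_left,
        ENNReal.tsum_mul_right]
      rw [ENNReal.ofReal_pow (hX0 ω), h, sq]
    simp_rw [e]
    have hm : ∀ i j, Measurable ((A i ∩ A j).indicator (1 : Ω → ENNReal)) := fun i j =>
      measurable_one.indicator ((hA i).inter (hA j))
    rw [lintegral_tsum fun i => (Measurable.tsum fun j => hm i j).aemeasurable]
    congr 1 with i
    rw [lintegral_tsum fun j => (hm i j).aemeasurable]
    simp_rw [lintegral_indicator_one ((hA _).inter (hA _))]
  -- Off-diagonal pairs are bounded by products; the diagonal contributes the mean.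
  have h3 : ∑' i, ∑' j, P (A i ∩ A j) ≤ (∑' i, P (A i)) ^ 2 + ∑' i, P (A i) := by
    calc ∑' i, ∑' j, P (A i ∩ A j)
        ≤ ∑' i, ∑' j, (P (A i) * P (A j) + if j = i then P (A i) else 0) := by
          refine ENNReal.tsum_le_tsum fun i => ENNReal.tsum_le_tsum fun j => ?_
          by_cases hij : j = i
          · subst hij; simp
          · simpa [hij] using hneg i j (Ne.symm hij)
      _ = _ := by
          simp_rw [ENNReal.tsum_add, tsum_ite_eq, ENNReal.tsum_mul_left, ENNReal.tsum_mul_right, sq]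
  have hM : 0 ≤ ∫ ω, X ω ∂P := integral_nonneg hX0
  rw [← h1, ← h2, ← ENNReal.ofReal_pow hM, ← ENNReal.ofReal_add (by positivity) hM,
    ENNReal.ofReal_le_ofReal_iff (by positivity)] at h3
  rw [variance_eq_sub hX]
  linarith

/-! ### Atoms and the counting function -/

theorem mem_atoms_iff {E : Type*} [MeasurableSpace E] (π : Measure E) [IsProbabilityMeasure π]
    {x : E} : x ∈ atoms π ↔ 0 < π.real {x} :=
  ⟨fun h => ENNReal.toReal_pos h.ne' (measure_ne_top _ _), fun h => (ENNReal.toReal_pos_iff.1 h).1⟩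

theorem measureReal_atoms_pos {E : Type*} [MeasurableSpace E] (π : Measure E)
    [IsProbabilityMeasure π] (hne : (atoms π).Nonempty) : 0 < π.real (atoms π) := by
  obtain ⟨x, hx⟩ := hne
  exact ((mem_atoms_iff π).1 hx).trans_le (measureReal_mono (Set.singleton_subset_iff.2 hx))

section Atoms

variable {E : Type*} [MeasurableSpace E] [MeasurableEq E] (π : Measure E)

theorem tsum_measure_singleton_le : ∑' x : E, π {x} ≤ π Set.univ :=
  (tsum_meas_le_meas_iUnion_of_disjoint π
    (fun x => measurableSet_singleton_of_measurableEq x)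
    (fun _ _ hxy => Set.disjoint_singleton.2 hxy)).trans (measure_mono (Set.subset_univ _))

variable [IsProbabilityMeasure π]

theorem countable_atoms : (atoms π).Countable := by
  have := Summable.countable_support_ennreal
    (ne_top_of_le_ne_top (measure_ne_top π _) (tsum_measure_singleton_le π))
  exact this.mono fun x (hx : 0 < π {x}) => hx.ne'

theorem measurableSet_atoms : MeasurableSet (atoms π) := by
  have : MeasurableSingletonClass E := ⟨measurableSet_singleton_of_measurableEq⟩
  exact (countable_atoms π).measurableSet

theorem finite_le_measureReal {c : ℝ} (hc : 0 < c) : {x : E | c ≤ π.real {x}}.Finite := by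
  refine (ENNReal.finite_const_le_of_tsum_ne_top
    (ne_top_of_le_ne_top (measure_ne_top π _) (tsum_measure_singleton_le π))
    (ENNReal.ofReal_pos.2 hc).ne').subset fun x hx => ?_
  exact (ENNReal.ofReal_le_iff_le_toReal (measure_ne_top _ _)).2 hx

theorem monotoneOn_atomCount : MonotoneOn (fun t => (atomCount π t : ℝ)) (Set.Ioi 0) := by
  intro s hs t ht hst
  have hs : 0 < s := hs
  have ht : 0 < t := ht
  refine Nat.cast_le.2 (Set.ncard_le_ncard (fun x hx => ?_)
    (finite_le_measureReal π (one_div_pos.2 ht)))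
  exact (one_div_le_one_div_of_le hs hst).trans hx

theorem atomCount_eq_zero {t : ℝ} (h0 : 0 < t) (h1 : t < 1) : atomCount π t = 0 := by
  rw [atomCount, Set.ncard_eq_zero (finite_le_measureReal π (one_div_pos.2 h0))]
  refine Set.eq_empty_of_forall_notMem fun x hx => ?_
  exact absurd (hx.trans measureReal_le_one) (not_le.2 ((one_lt_div h0).2 h1))

theorem tendsto_atomCount (hinf : (atoms π).Infinite) :
    Tendsto (fun t => (atomCount π t : ℝ)) atTop atTop := by
  refine tendsto_natCast_atTop_atTop.comp (tendsto_atTop.2 fun N => ?_)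
  obtain ⟨F, hF, hcard⟩ := hinf.exists_subset_card_eq N
  have : ∀ᶠ t : ℝ in atTop, ∀ x ∈ F, 1 / t ≤ π.real {x} := by
    refine (Finset.eventually_all F).2 fun x hx => ?_
    have hx : 0 < π.real {x} := (mem_atoms_iff π).1 (hF hx)
    filter_upwards [eventually_ge_atTop (1 / π.real {x})] with t ht
    exact (one_div_le (lt_of_lt_of_le (one_div_pos.2 hx) ht) hx).2 ht
  filter_upwards [this, eventually_gt_atTop 0] with t ht ht0
  rw [← hcard, ← Set.ncard_coe_finset]
  exact Set.ncard_le_ncard (fun x hx => ht x hx) (finite_le_measureReal π (one_div_pos.2 ht0))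

theorem atomCount_atomicPart (hne : (atoms π).Nonempty) (t : ℝ) :
    atomCount (atomicPart π) t = atomCount π (t / π.real (atoms π)) := by
  have hDpos := measureReal_atoms_pos π hne
  have e : ∀ x, (atomicPart π).real {x} = π.real {x} / π.real (atoms π) := by
    intro x
    rw [atomicPart, measureReal_ennreal_smul_apply, measureReal_restrict_apply
      (measurableSet_singleton_of_measurableEq x), ENNReal.toReal_inv, inv_mul_eq_div]
    congr 1
    by_cases hx : x ∈ atoms π
    · rw [Set.inter_eq_left.2 (Set.singleton_subset_iff.2 hx)]
    · rw [Set.singleton_inter_eq_empty.2 hx]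
      have : π {x} = 0 := by simpa [atoms] using hx
      simp [Measure.real, this]
  unfold atomCount
  congr 1 with x
  simp only [Set.mem_ofPred_eq, e, one_div_div]
  rw [le_div_iff₀ hDpos, one_div_mul_eq_div]

/-- The two counting functions differ by the dilation t ↦ t/π(Δ), which commutes with t ↦ ct. The
rest of the argument can therefore use π itself. -/
theorem isRegularlyVarying_atomCount (hne : (atoms π).Nonempty) {γ : ℝ}
    (h : IsRegularlyVarying (fun t => (atomCount (atomicPart π) t : ℝ)) γ) :
    IsRegularlyVarying (fun t => (atomCount π t : ℝ)) γ := by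
  have hD := measureReal_atoms_pos π hne
  intro c hc
  refine ((h c hc).comp (tendsto_id.const_mul_atTop hD)).congr fun t => ?_
  simp only [Function.comp_apply, id, atomCount_atomicPart π hne]
  rw [mul_left_comm, mul_div_cancel_left₀ _ hD.ne', mul_div_cancel_left₀ _ hD.ne']

end Atoms

/-! ### Atoms visited at least k times -/

/-- The number of atoms of `π` visited at least `k` times among the first `n` terms. -/
def atomGe {E : Type*} [MeasurableSpace E] (π : Measure E) (s : ℕ → E) (n k : ℕ) : ℕ :=
  (atoms π ∩ {x | k ≤ visits s n x}).ncard

section AtomGe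

variable {E : Type*} [MeasurableSpace E] (π : Measure E) (s : ℕ → E)

theorem finite_atoms_inter_le_visits (n : ℕ) {k : ℕ} (hk : 1 ≤ k) :
    (atoms π ∩ {x | k ≤ visits s n x}).Finite :=
  (finite_le_visits s n hk).inter_of_right _

theorem atomGe_mono {k : ℕ} (hk : 1 ≤ k) : Monotone fun n => atomGe π s n k := fun _ n hmn =>
  Set.ncard_le_ncard (Set.inter_subset_inter_right _ fun x hx => hx.trans (visits_mono s x hmn))
    (finite_atoms_inter_le_visits π s n hk)

theorem atomGe_zero {k : ℕ} (hk : 1 ≤ k) : atomGe π s 0 k = 0 := by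
  have : ¬ k ≤ 0 := by omega
  simp [atomGe, this]

theorem atomGe_succ_le (n : ℕ) {k : ℕ} (hk : 1 ≤ k) :
    atomGe π s (n + 1) k ≤ atomGe π s n k + 1 := by
  classical
  refine (Set.ncard_le_ncard (t := insert (s n) (atoms π ∩ {x | k ≤ visits s n x}))
    (fun x hx => ?_) ((finite_atoms_inter_le_visits π s n hk).insert _)).trans
    (Set.ncard_insert_le _ _)
  by_cases h : s n = x
  · exact Or.inl h.symm
  · have := hx.2
    simp only [Set.mem_ofPred_eq, visits_succ, h, if_false, add_zero] at this
    exact Or.inr ⟨hx.1, this⟩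

theorem atomGe_le (n : ℕ) {k : ℕ} (hk : 1 ≤ k) : atomGe π s n k ≤ n := by
  induction n with
  | zero => exact (atomGe_zero π s hk).le
  | succ n ih => exact (atomGe_succ_le π s n hk).trans (Nat.succ_le_succ ih)

/-- The sum of indicators over the countable set of atoms yields measurability, the mean and the
variance bound without summability conditions. -/
theorem ofReal_atomGe {Ω : Type*} (ξ : ℕ → Ω → E) (n : ℕ) {k : ℕ} (hk : 1 ≤ k) (ω : Ω) :
    ENNReal.ofReal (atomGe π (fun i => ξ i ω) n k) =
      ∑' x : atoms π, {ω | k ≤ visits (fun i => ξ i ω) n x}.indicator (1 : Ω → ENNReal) ω := by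
  rw [ENNReal.ofReal_natCast, atomGe, ← tsum_indicator_one_eq_ncard
    (finite_atoms_inter_le_visits π _ n hk)]
  rfl

end AtomGe

theorem ofReal_binomTail {n : ℕ} (hn : n ≠ 0) (k : ℕ) {p : ℝ} (hp0 : 0 ≤ p) (hp1 : p ≤ 1) :
    ENNReal.ofReal (binomTail (n + 1) (k + 1) p) =
      ∫⁻ v in Set.Ioi (0 : ℝ), (Set.Iic (n * p)).indicator
        (fun v => ENNReal.ofReal (binomDensity n k v)) v := by
  rw [lintegral_indicator measurableSet_Iic, Measure.restrict_restrict measurableSet_Iic,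
    Set.inter_comm, Set.Ioi_inter_Iic, ← integral_binomDensity hn,
    intervalIntegral.integral_of_le (by positivity), ofReal_integral_eq_lintegral_ofReal]
  · exact ((continuous_binomDensity n k).integrableOn_Icc).mono_set Set.Ioc_subset_Icc_self
  · filter_upwards [ae_restrict_mem measurableSet_Ioc] with v hv
    exact binomDensity_nonneg hv.1.le (hv.2.trans (mul_le_of_le_one_right (by positivity) hp1))

/-! ### Mean, variance and almost sure growth -/

section Expectation

variable {E : Type*} [MeasurableSpace E] [MeasurableEq E] {Ω : Type*} [MeasurableSpace Ω]
  {P : Measure Ω} {π : Measure E} [IsProbabilityMeasure π] {ξ : ℕ → Ω → E}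

theorem measurable_atomGe (hmeas : ∀ i, Measurable (ξ i)) (n : ℕ) {k : ℕ} (hk : 1 ≤ k) :
    Measurable fun ω => (atomGe π (fun i => ξ i ω) n k : ℝ) := by
  have := (countable_atoms π).to_subtype
  have h : Measurable fun ω => ENNReal.ofReal (atomGe π (fun i => ξ i ω) n k : ℝ) := by
    simp_rw [ofReal_atomGe π ξ n hk]
    exact Measurable.tsum fun x => measurable_one.indicator (measurableSet_le_visits hmeas n k x)
  simpa using h.ennreal_toReal

variable [IsProbabilityMeasure P]

theorem memLp_atomGe (hmeas : ∀ i, Measurable (ξ i)) (n : ℕ) {k : ℕ} (hk : 1 ≤ k) :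
    MemLp (fun ω => (atomGe π (fun i => ξ i ω) n k : ℝ)) 2 P :=
  MemLp.of_bound (measurable_atomGe hmeas n hk).aestronglyMeasurable n
    (Eventually.of_forall fun ω => by
      rw [Real.norm_of_nonneg (Nat.cast_nonneg _)]
      exact_mod_cast atomGe_le π _ n hk)

theorem variance_atomGe_le (hmeas : ∀ i, Measurable (ξ i)) (hindep : iIndepFun ξ P)
    (hlaw : ∀ i, P.map (ξ i) = π) (n : ℕ) {k : ℕ} (hk : 1 ≤ k) :
    Var[fun ω => (atomGe π (fun i => ξ i ω) n k : ℝ); P] ≤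
      ∫ ω, (atomGe π (fun i => ξ i ω) n k : ℝ) ∂P := by
  have := (countable_atoms π).to_subtype
  refine variance_le_integral_of_negative_correlation
    (A := fun x : atoms π => {ω | k ≤ visits (fun i => ξ i ω) n x})
    (fun x => measurableSet_le_visits hmeas n k x) (fun x y hxy => ?_)
    (fun ω => Nat.cast_nonneg _) (memLp_atomGe hmeas n hk) (ofReal_atomGe π ξ n hk)
  have := measureReal_le_visits_and_le hmeas hindep hlaw n k k (Subtype.coe_injective.ne hxy)
  rw [Measure.real, Measure.real, Measure.real, ← ENNReal.toReal_mul, ENNReal.toReal_le_toReal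
    (measure_ne_top _ _) (ENNReal.mul_ne_top (measure_ne_top _ _) (measure_ne_top _ _))] at this
  exact this

/-- Tonelli: for fixed v > 0, the atoms x with v ≤ nπ{x} are exactly the points counted by A(n/v).
-/
theorem integral_atomGe (hmeas : ∀ i, Measurable (ξ i)) (hindep : iIndepFun ξ P)
    (hlaw : ∀ i, P.map (ξ i) = π) {n : ℕ} (hn : n ≠ 0) (k : ℕ) :
    ∫ ω, (atomGe π (fun i => ξ i ω) (n + 1) (k + 1) : ℝ) ∂P =
      ∫ v in Set.Ioi (0 : ℝ), (atomCount π (n / v) : ℝ) * binomDensity n k v := by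
  have := (countable_atoms π).to_subtype
  have hk : 1 ≤ k + 1 := by omega
  have hn0 : (0 : ℝ) < n := by positivity
  rw [integral_eq_lintegral_of_nonneg_ae (Eventually.of_forall fun ω => Nat.cast_nonneg _)
    (measurable_atomGe hmeas (n + 1) hk).aestronglyMeasurable,
    integral_eq_lintegral_of_nonneg_ae _
      (aestronglyMeasurable_mul_binomDensity (monotoneOn_atomCount π) n k)]
  · congr 1
    simp_rw [ofReal_atomGe π ξ (n + 1) hk]
    rw [lintegral_tsum fun x : atoms π => (measurable_one.indicator
      (measurableSet_le_visits hmeas (n + 1) (k + 1) x)).aemeasurable]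
    simp_rw [lintegral_indicator_one (measurableSet_le_visits hmeas (n + 1) (k + 1) _),
      ← ofReal_measureReal (measure_ne_top _ _), measureReal_le_visits hmeas hindep hlaw,
      ofReal_binomTail hn k measureReal_nonneg measureReal_le_one]
    rw [← lintegral_tsum fun x : atoms π => ((continuous_binomDensity n k).measurable.ennreal_ofReal.indicator
      measurableSet_Iic).aemeasurable]
    refine setLIntegral_congr_fun measurableSet_Ioi fun v hv => ?_
    have hv : 0 < v := hv
    have hset : {x | 1 / (n / v) ≤ π.real {x}} =
        atoms π ∩ {x | 1 / (n / v) ≤ π.real {x}} := by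
      refine (Set.inter_eq_right.2 fun x hx => (mem_atoms_iff π).2 ?_).symm
      exact lt_of_lt_of_le (by positivity) hx
    rw [ENNReal.ofReal_mul (Nat.cast_nonneg _), ENNReal.ofReal_natCast, atomCount, hset,
      ← tsum_indicator_one_eq_ncard (hset ▸ finite_le_measureReal π (by positivity)),
      ← ENNReal.tsum_mul_right]
    congr 1 with x
    have : v ∈ Set.Iic (n * π.real {(x : E)}) ↔
        (x : E) ∈ {x | 1 / (n / v) ≤ π.real {x}} := by
      rw [Set.mem_Iic, Set.mem_ofPred_eq, one_div_div, div_le_iff₀' hn0]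
    by_cases h : v ∈ Set.Iic (n * π.real {(x : E)})
    · rw [Set.indicator_of_mem h, Set.indicator_of_mem (this.1 h), Pi.one_apply, one_mul]
    · rw [Set.indicator_of_notMem h, Set.indicator_of_notMem (this.not.1 h), zero_mul]
  · filter_upwards [ae_restrict_mem measurableSet_Ioi] with v hv
    have hv : 0 < v := hv
    rcases lt_or_ge (n : ℝ) v with hvn | hvn
    · rw [atomCount_eq_zero π (by positivity) ((div_lt_one hv).2 hvn)]
      simp
    · exact mul_nonneg (Nat.cast_nonneg _) (binomDensity_nonneg hv.le hvn)

/-- Almost surely, the number of atoms visited at least `k + 1` times is asymptotically proportional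
to the counting function. -/
theorem ae_tendsto_atomGe_div_atomCount (hinf : (atoms π).Infinite) {γ : ℝ}
    (hγ : γ ∈ Set.Icc (0 : ℝ) 1) (hreg : IsRegularlyVarying (fun t => (atomCount π t : ℝ)) γ)
    (hmeas : ∀ i, Measurable (ξ i)) (hindep : iIndepFun ξ P) (hlaw : ∀ i, P.map (ξ i) = π)
    {k : ℕ} (hk : 1 ≤ k) :
    ∀ᵐ ω ∂P, Tendsto (fun n : ℕ => (atomGe π (fun i => ξ i ω) (n + 1) (k + 1) : ℝ) /
      atomCount π n) atTop (𝓝 (Real.Gamma (k + 1 - γ) / k.factorial)) := by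
  have hk1 : 1 ≤ k + 1 := by omega
  have hk' : (1 : ℝ) ≤ k := by exact_mod_cast hk
  have hcount := tendsto_atomCount π hinf
  set M : ℕ → ℝ := fun n => ∫ ω, (atomGe π (fun i => ξ i ω) n (k + 1) : ℝ) ∂P
  have hM : Tendsto (fun n : ℕ => M (n + 1) / atomCount π n) atTop
      (𝓝 (Real.Gamma (k + 1 - γ) / k.factorial)) := by
    refine (tendsto_integral_mul_binomDensity hγ hreg (monotoneOn_atomCount π)
      (fun t => Nat.cast_nonneg _) (hcount.eventually_gt_atTop 0)
      (fun t h0 h1 => by rw [atomCount_eq_zero π h0 h1, Nat.cast_zero]) hk).congr' ?_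
    filter_upwards [eventually_ne_atTop 0] with n hn
    rw [← integral_atomGe hmeas hindep hlaw hn]
  have hcountn : Tendsto (fun n : ℕ => (atomCount π n : ℝ)) atTop atTop :=
    hcount.comp tendsto_natCast_atTop_atTop
  have hc : 0 < Real.Gamma (k + 1 - γ) / k.factorial :=
    div_pos (Real.Gamma_pos_of_pos (by linarith [hγ.2])) (by positivity)
  have hMlim : Tendsto (fun n => M (n + 1)) atTop atTop := by
    refine (hM.pos_mul_atTop hc hcountn).congr' ?_
    filter_upwards [hcountn.eventually_gt_atTop 0] with n hn
    exact div_mul_cancel₀ _ hn.ne'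
  filter_upwards [ae_tendsto_div_integral_of_variance_le
    (fun n => measurable_atomGe (π := π) hmeas n hk1)
    (fun ω m n hmn => Nat.cast_le.2 (atomGe_mono π _ hk1 hmn))
    (fun ω => by rw [atomGe_zero π _ hk1, Nat.cast_zero])
    (fun n ω => by exact_mod_cast atomGe_succ_le π _ n hk1)
    (fun n => variance_atomGe_le hmeas hindep hlaw n hk1)
    ((tendsto_add_atTop_iff_nat 1).1 hMlim)] with ω hω
  have := ((tendsto_add_atTop_iff_nat 1).2 hω).mul hM
  rw [one_mul] at this
  refine this.congr' ?_
  filter_upwards [hMlim.eventually_gt_atTop 0] with n hn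
  exact div_mul_div_cancel₀ hn.ne'

end Expectation

/-! ### Splitting the range into atoms and non-atoms -/

section Range

variable {E : Type*} (s : ℕ → E)

theorem rangeCard_eq_rangeGe_one (n : ℕ) : rangeCard s n = rangeGe s n 1 := by
  simp_rw [rangeCard, rangeGe, one_le_visits_iff]

theorem rangeGe_eq_add (n : ℕ) {k : ℕ} (hk : 1 ≤ k) :
    rangeGe s n k = rangeEq s n k + rangeGe s n (k + 1) := by
  have hfin := finite_le_visits s n hk
  have e : {x | k ≤ visits s n x} = {x | visits s n x = k} ∪ {x | k + 1 ≤ visits s n x} := by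
    ext x; simp only [Set.mem_ofPred_eq, Set.mem_union]; omega
  rw [rangeGe, rangeEq, rangeGe, e, Set.ncard_union_eq _ (hfin.subset (e ▸ Set.subset_union_left))
    (hfin.subset (e ▸ Set.subset_union_right))]
  refine Set.disjoint_left.2 fun x (hx : _ = k) (hx' : k + 1 ≤ _) => ?_
  omega

variable [MeasurableSpace E] (π : Measure E)

theorem rangeGe_eq_atomGe {s : ℕ → E} (hs : ∀ i j, i ≠ j → s i = s j → s i ∈ atoms π) (n : ℕ)
    {k : ℕ} (hk : 2 ≤ k) : rangeGe s n k = atomGe π s n k := by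
  rw [rangeGe, atomGe, Set.inter_eq_right.2]
  intro x hx
  have : 1 < {i : ℕ | i < n ∧ s i = x}.ncard := lt_of_lt_of_le hk hx
  obtain ⟨i, hi, j, hj, hij⟩ := (Set.one_lt_ncard
    ((Set.finite_lt_nat n).subset fun i hi => hi.1)).1 this
  exact hi.2 ▸ hs i j hij (hi.2.trans hj.2.symm)

/-- Draws outside Δ never repeat under `hs`, so distinct non-atomic values can be counted by their
indices, to which the strong law applies. -/
theorem rangeGe_one_eq {s : ℕ → E} (hs : ∀ i j, i ≠ j → s i = s j → s i ∈ atoms π) (n : ℕ) :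
    rangeGe s n 1 = {i : ℕ | i < n ∧ s i ∈ (atoms π)ᶜ}.ncard + atomGe π s n 1 := by
  have e : {x | 1 ≤ visits s n x} =
      s '' {i : ℕ | i < n ∧ s i ∈ (atoms π)ᶜ} ∪ (atoms π ∩ {x | 1 ≤ visits s n x}) := by
    ext x
    by_cases hx : x ∈ atoms π
    · have : x ∉ s '' {i : ℕ | i < n ∧ s i ∈ (atoms π)ᶜ} := by
        rintro ⟨i, hi, rfl⟩; exact hi.2 hx
      simp only [Set.mem_union, this, Set.mem_inter_iff, hx, true_and, false_or]
    · simp only [Set.mem_ofPred_eq, one_le_visits_iff, Set.mem_union, Set.mem_image,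
        Set.mem_inter_iff, hx, false_and, or_false]
      refine exists_congr fun i => ⟨fun h => ⟨⟨h.1, h.2 ▸ hx⟩, h.2⟩, fun h => ⟨h.1.1, h.2⟩⟩
  have hfin : {i : ℕ | i < n ∧ s i ∈ (atoms π)ᶜ}.Finite :=
    (Set.finite_lt_nat n).subset fun i hi => hi.1
  rw [rangeGe, e, Set.ncard_union_eq _ (hfin.image s) (finite_atoms_inter_le_visits π s n le_rfl),
    Set.InjOn.ncard_image, atomGe]
  · intro i hi j _ hij
    by_contra h
    exact hi.2 (hs i j h hij)
  · refine Set.disjoint_left.2 ?_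
    rintro _ ⟨i, hi, rfl⟩ hx
    exact hi.2 hx.1

theorem atomGe_one_le {F : Set E} (hF : F.Finite) (n : ℕ) :
    atomGe π s n 1 ≤ F.ncard + {i : ℕ | i < n ∧ s i ∈ atoms π \ F}.ncard := by
  have hfin : {i : ℕ | i < n ∧ s i ∈ atoms π \ F}.Finite :=
    (Set.finite_lt_nat n).subset fun i hi => hi.1
  calc atomGe π s n 1 ≤ (F ∪ s '' {i : ℕ | i < n ∧ s i ∈ atoms π \ F}).ncard := by
        refine Set.ncard_le_ncard (fun x hx => ?_) (hF.union (hfin.image s))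
        obtain ⟨i, hi, h⟩ := (one_le_visits_iff s n x).1 hx.2
        by_cases hxF : x ∈ F
        · exact Or.inl hxF
        · exact Or.inr ⟨i, ⟨hi, h ▸ ⟨hx.1, hxF⟩⟩, h⟩
    _ ≤ _ := (Set.ncard_union_le _ _).trans (Nat.add_le_add_left (Set.ncard_image_le hfin) _)

end Range

/-! ### Strong law and negligibility of the atomic range -/

section AlmostSure

variable {E : Type*} [MeasurableSpace E] {Ω : Type*} [MeasurableSpace Ω]
  {P : Measure Ω} [IsProbabilityMeasure P] {π : Measure E} {ξ : ℕ → Ω → E}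

/-- Strong law of large numbers for the empirical frequency of a set. -/
theorem ae_tendsto_ncard_mem_div (hmeas : ∀ i, Measurable (ξ i)) (hindep : iIndepFun ξ P)
    (hlaw : ∀ i, P.map (ξ i) = π) {B : Set E} (hB : MeasurableSet B) :
    ∀ᵐ ω ∂P, Tendsto (fun n : ℕ => ({i : ℕ | i < n ∧ ξ i ω ∈ B}.ncard : ℝ) / n) atTop
      (𝓝 (π.real B)) := by
  classical
  have hφ : Measurable (B.indicator (1 : E → ℝ)) := measurable_one.indicator hB
  have hint : Integrable (fun ω => B.indicator (1 : E → ℝ) (ξ 0 ω)) P := by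
    have : (fun ω => B.indicator (1 : E → ℝ) (ξ 0 ω)) = (ξ 0 ⁻¹' B).indicator 1 := rfl
    rw [this]
    exact (integrable_const 1).indicator (hmeas 0 hB)
  have h := strong_law_ae_real (fun i ω => B.indicator (1 : E → ℝ) (ξ i ω)) hint
    (fun i j hij => (hindep.indepFun hij).comp hφ hφ)
    (fun i => IdentDistrib.comp ⟨(hmeas i).aemeasurable, (hmeas 0).aemeasurable,
      (hlaw i).trans (hlaw 0).symm⟩ hφ)
  have hexp : ∫ ω, B.indicator (1 : E → ℝ) (ξ 0 ω) ∂P = π.real B := by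
    rw [← hlaw 0, ← integral_indicator_one hB,
      integral_map (hmeas 0).aemeasurable hφ.aestronglyMeasurable]
  rw [hexp] at h
  filter_upwards [h] with ω hω
  refine hω.congr fun n => ?_
  congr 1
  have : {i : ℕ | i < n ∧ ξ i ω ∈ B} = ((Finset.range n).filter fun i => ξ i ω ∈ B : Finset ℕ) := by
    ext i; simp
  rw [this, Set.ncard_coe_finset, Finset.card_filter]
  push_cast
  exact Finset.sum_congr rfl fun i _ => Set.indicator_apply _ _ _

variable [MeasurableEq E] [IsProbabilityMeasure π]

/-- Fubini on the diagonal outside Δ × E: each slice is empty or a singleton of measure zero. -/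
theorem ae_eq_imp_mem_atoms (hmeas : ∀ i, Measurable (ξ i)) (hindep : iIndepFun ξ P)
    (hlaw : ∀ i, P.map (ξ i) = π) :
    ∀ᵐ ω ∂P, ∀ i j, i ≠ j → ξ i ω = ξ j ω → ξ i ω ∈ atoms π := by
  refine ae_all_iff.2 fun i => ae_all_iff.2 fun j => ?_
  by_cases hij : i = j
  · exact Eventually.of_forall fun ω h => absurd hij h
  have hprod := (indepFun_iff_map_prod_eq_prod_map_map (hmeas i).aemeasurable
    (hmeas j).aemeasurable).1 (hindep.indepFun hij)
  rw [hlaw, hlaw] at hprod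
  have hS : MeasurableSet {q : E × E | q.1 = q.2 ∧ q.1 ∈ (atoms π)ᶜ} :=
    (measurableSet_eq_fun measurable_fst measurable_snd).inter
      (measurable_fst (measurableSet_atoms π).compl)
  have h0 : (π.prod π) {q : E × E | q.1 = q.2 ∧ q.1 ∈ (atoms π)ᶜ} = 0 := by
    rw [Measure.measure_prod_null hS]
    refine Eventually.of_forall fun x => ?_
    by_cases hx : x ∈ atoms π
    · have : Prod.mk x ⁻¹' {q : E × E | q.1 = q.2 ∧ q.1 ∈ (atoms π)ᶜ} = ∅ := by
        ext y; simp [hx]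
      exact (congrArg π this).trans measure_empty
    · refine measure_mono_null (t := {x}) (fun y hy => ?_) (by simpa [atoms] using hx)
      exact hy.1.symm
  rw [← hprod, Measure.map_apply ((hmeas i).prodMk (hmeas j)) hS] at h0
  filter_upwards [measure_eq_zero_iff_ae_notMem.1 h0] with ω hω _ heq
  by_contra hc
  exact hω ⟨heq, hc⟩

/-- Finitely many heavy atoms contribute a bounded number of values, and the light atoms at most the
number of draws falling among them, whose frequency is arbitrarily small. -/
theorem ae_tendsto_atomGe_one_div (hmeas : ∀ i, Measurable (ξ i)) (hindep : iIndepFun ξ P)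
    (hlaw : ∀ i, P.map (ξ i) = π) :
    ∀ᵐ ω ∂P, Tendsto (fun n : ℕ => (atomGe π (fun i => ξ i ω) n 1 : ℝ) / n) atTop (𝓝 0) := by
  set F : ℕ → Set E := fun m => {x | 1 / ((m : ℝ) + 1) ≤ π.real {x}}
  have hF : ∀ m, (F m).Finite := fun m => finite_le_measureReal π (by positivity)
  have hmeasF : ∀ m, MeasurableSet (atoms π \ F m) := by
    have : MeasurableSingletonClass E := ⟨measurableSet_singleton_of_measurableEq⟩
    exact fun m => (measurableSet_atoms π).diff (hF m).measurableSet
  have hlim : Tendsto (fun m => π.real (atoms π \ F m)) atTop (𝓝 0) := by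
    have hempty : ⋂ m, (atoms π \ F m) = ∅ := by
      refine Set.eq_empty_of_forall_notMem fun x hx => ?_
      rw [Set.mem_iInter] at hx
      obtain ⟨m, hm⟩ := exists_nat_one_div_lt ((mem_atoms_iff π).1 (hx 0).1)
      exact (hx m).2 hm.le
    have := tendsto_measure_iInter_atTop (μ := π) (fun m => (hmeasF m).nullMeasurableSet)
      (fun a b hab => Set.sdiff_subset_sdiff_right fun x hx =>
        (one_div_le_one_div_of_le (Nat.cast_add_one_pos a)
          (by gcongr : (a : ℝ) + 1 ≤ b + 1)).trans hx)
      ⟨0, measure_ne_top _ _⟩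
    rw [hempty, measure_empty] at this
    exact (ENNReal.tendsto_toReal ENNReal.zero_ne_top).comp this
  filter_upwards [ae_all_iff.2 fun m => ae_tendsto_ncard_mem_div hmeas hindep hlaw (hmeasF m)]
    with ω hω
  refine tendsto_order.2 ⟨fun a ha => Eventually.of_forall fun n => ha.trans_le (by positivity),
    fun a ha => ?_⟩
  obtain ⟨m, hm⟩ := (hlim.eventually (gt_mem_nhds ha)).exists
  have h1 : Tendsto (fun n : ℕ => ((F m).ncard : ℝ) / n +
      ({i : ℕ | i < n ∧ ξ i ω ∈ atoms π \ F m}.ncard : ℝ) / n) atTop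
      (𝓝 (0 + π.real (atoms π \ F m))) :=
    (tendsto_const_div_atTop_nhds_zero_nat _).add (hω m)
  rw [zero_add] at h1
  filter_upwards [h1.eventually (gt_mem_nhds hm)] with n hn
  refine lt_of_le_of_lt ?_ hn
  rw [← add_div]
  gcongr
  exact_mod_cast atomGe_one_le (fun i => ξ i ω) π (hF m) n

end AlmostSure

/-! ### The limiting constants -/

theorem rCoeff_div_eq (k : ℕ) {γ : ℝ} (hγ : γ < 1) :
    rCoeff k γ / (1 - γ) = γ * Real.Gamma (k - γ) / (k.factorial * Real.Gamma (2 - γ)) := by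
  have : Real.Gamma (2 - γ) = (1 - γ) * Real.Gamma (1 - γ) := by
    rw [← Real.Gamma_add_one (by linarith)]; ring_nf
  rw [rCoeff, this, div_div]; ring

/-- Normalising by C_1 = Γ(2 - γ), which is regular at γ = 1 unlike Γ(1 - γ), unites the three cases
in the single expression (C_j - C_{j+1})/C_1. -/
theorem gamma_limit_eq {j : ℕ} (hj : 1 ≤ j) {γ : ℝ} (hγ : γ ∈ Set.Icc (0 : ℝ) 1) :
    Real.Gamma (j + 1 - γ) / j.factorial * (γ / ((j + 1 : ℕ) : ℝ)) / Real.Gamma (2 - γ) =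
      if γ = 0 then 0
      else if γ = 1 then 1 / (((j + 1 : ℕ) : ℝ) * (((j + 1 : ℕ) : ℝ) - 1))
      else rCoeff (j + 1) γ / (1 - γ) := by
  split_ifs with h0 h1
  · simp [h0]
  · obtain ⟨i, rfl⟩ : ∃ i, j = i + 1 := ⟨j - 1, by omega⟩
    subst h1
    have e1 : Real.Gamma (((i + 1 : ℕ) : ℝ) + 1 - 1) = i.factorial := by
      rw [← Real.Gamma_nat_eq_factorial]; push_cast; ring_nf
    have e2 : Real.Gamma (2 - 1) = 1 := by norm_num
    rw [e1, e2, Nat.factorial_succ]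
    push_cast
    have : (i.factorial : ℝ) ≠ 0 := by positivity
    field_simp
    ring
  · have hlt : γ < 1 := lt_of_le_of_ne hγ.2 h1
    rw [rCoeff_div_eq _ hlt, Nat.factorial_succ]
    have : Real.Gamma (2 - γ) ≠ 0 := (Real.Gamma_pos_of_pos (by linarith)).ne'
    push_cast
    field_simp

end RangeRenewal

end

/-! ### The main theorem -/

theorem theorem1 {E : Type*} [MeasurableSpace E] [MeasurableEq E]
    {Ω : Type*} [MeasurableSpace Ω] (P : Measure Ω) [IsProbabilityMeasure P]
    (π : Measure E) [IsProbabilityMeasure π]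
    (hinf : (RangeRenewal.atoms π).Infinite)
    (γ : ℝ) (hreg : RangeRenewal.IsRegular (RangeRenewal.atomicPart π) γ)
    (ξ : ℕ → Ω → E) (hmeas : ∀ i, Measurable (ξ i)) (hindep : iIndepFun ξ P)
    (hlaw : ∀ i, P.map (ξ i) = π) :
    ∀ᵐ ω ∂P,
      Tendsto (fun n : ℕ => (RangeRenewal.rangeCard (fun i => ξ i ω) n : ℝ) / n)
        atTop (𝓝 (1 - π.real (RangeRenewal.atoms π))) ∧
      Tendsto (fun n : ℕ => (RangeRenewal.rangeEq (fun i => ξ i ω) n 1 : ℝ) / n)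
        atTop (𝓝 (1 - π.real (RangeRenewal.atoms π))) ∧
      ∀ k : ℕ, 2 ≤ k →
        -- the denominators below are eventually nonzero
        (∀ᶠ n : ℕ in atTop, 0 < RangeRenewal.rangeGe (fun i => ξ i ω) n 2 ∧
          0 < RangeRenewal.rangeGe (fun i => ξ i ω) n k) ∧
        Tendsto
          (fun n : ℕ => (RangeRenewal.rangeEq (fun i => ξ i ω) n k : ℝ) /
            RangeRenewal.rangeGe (fun i => ξ i ω) n 2)
          atTop (𝓝 (if γ = 0 then 0
            else if γ = 1 then 1 / ((k : ℝ) * ((k : ℝ) - 1))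
            else RangeRenewal.rCoeff k γ / (1 - γ))) ∧
        Tendsto
          (fun n : ℕ => (RangeRenewal.rangeEq (fun i => ξ i ω) n k : ℝ) /
            RangeRenewal.rangeGe (fun i => ξ i ω) n k)
          atTop (𝓝 (if γ = 0 then 0 else γ / k)) := by
  have hne := hinf.nonempty
  have hγ := hreg.1
  have hrv := RangeRenewal.isRegularlyVarying_atomCount π hne hreg.2
  have hcount : Tendsto (fun n : ℕ => (RangeRenewal.atomCount π n : ℝ)) atTop atTop :=
    (RangeRenewal.tendsto_atomCount π hinf).comp tendsto_natCast_atTop_atTop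
  have hall : ∀ᵐ ω ∂P, ∀ j : ℕ, 1 ≤ j → Tendsto (fun n : ℕ =>
      (RangeRenewal.atomGe π (fun i => ξ i ω) (n + 1) (j + 1) : ℝ) / RangeRenewal.atomCount π n)
      atTop (𝓝 (Real.Gamma (j + 1 - γ) / j.factorial)) :=
    ae_all_iff.2 fun j => by
      by_cases hj : 1 ≤ j
      · filter_upwards [RangeRenewal.ae_tendsto_atomGe_div_atomCount hinf hγ hrv hmeas hindep hlaw
          hj] with ω hω _ using hω
      · exact Eventually.of_forall fun _ h => absurd h hj
  filter_upwards [hall, RangeRenewal.ae_eq_imp_mem_atoms hmeas hindep hlaw,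
    RangeRenewal.ae_tendsto_atomGe_one_div hmeas hindep hlaw,
    RangeRenewal.ae_tendsto_ncard_mem_div hmeas hindep hlaw
      (RangeRenewal.measurableSet_atoms π).compl] with ω hω hs h1 hc
  rw [probReal_compl_eq_one_sub (RangeRenewal.measurableSet_atoms π)] at hc
  set s : ℕ → E := fun i => ξ i ω
  have hGe : ∀ n j : ℕ, 1 ≤ j → RangeRenewal.rangeGe s n (j + 1) =
      RangeRenewal.atomGe π s n (j + 1) := fun n j hj =>
    RangeRenewal.rangeGe_eq_atomGe π hs n (by omega)
  have hrange : Tendsto (fun n : ℕ => (RangeRenewal.rangeCard s n : ℝ) / n) atTop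
      (𝓝 (1 - π.real (RangeRenewal.atoms π))) := by
    have := hc.add h1
    rw [add_zero] at this
    refine this.congr fun n => ?_
    rw [RangeRenewal.rangeCard_eq_rangeGe_one, RangeRenewal.rangeGe_one_eq π hs, ← add_div]
    push_cast
    rfl
  -- Points visited twice are atoms, hence o(n) in number; this lets R_{n,1} inherit the limit of
  -- R_n.
  have htwo : Tendsto (fun n : ℕ => (RangeRenewal.rangeGe s n 2 : ℝ) / n) atTop (𝓝 0) := by
    refine tendsto_of_tendsto_of_tendsto_of_le_of_le tendsto_const_nhds h1
      (fun n => by positivity) fun n => ?_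
    simp only
    rw [hGe n 1 le_rfl]
    gcongr
    exact Set.ncard_le_ncard (Set.inter_subset_inter_right _ fun x hx =>
        show 1 ≤ RangeRenewal.visits s n x from one_le_two.trans hx)
      (RangeRenewal.finite_atoms_inter_le_visits π s n le_rfl)
  refine ⟨hrange, ?_, fun k hk => ?_⟩
  · have := hrange.sub htwo
    rw [sub_zero] at this
    refine this.congr fun n => ?_
    rw [RangeRenewal.rangeCard_eq_rangeGe_one, RangeRenewal.rangeGe_eq_add s n le_rfl, ← sub_div]
    push_cast
    ring
  obtain ⟨j, rfl⟩ : ∃ j, k = j + 1 := ⟨k - 1, by omega⟩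
  have hj : 1 ≤ j := by omega
  have hj' : (1 : ℝ) ≤ j := by exact_mod_cast hj
  have hC : ∀ j : ℕ, 1 ≤ j → 0 < Real.Gamma (j + 1 - γ) / j.factorial := fun j hj => by
    have : (1 : ℝ) ≤ j := by exact_mod_cast hj
    exact div_pos (Real.Gamma_pos_of_pos (by linarith [hγ.2])) (by positivity)
  have hpos : ∀ j : ℕ, 1 ≤ j → ∀ᶠ n : ℕ in atTop, 0 < RangeRenewal.rangeGe s n (j + 1) := by
    intro j hj
    have : ∀ᶠ n : ℕ in atTop, 0 < RangeRenewal.rangeGe s (n + 1) (j + 1) := by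
      filter_upwards [(hω j hj).eventually (lt_mem_nhds (hC j hj))] with n hn
      rw [hGe _ j hj]
      by_contra h0
      have h0 : RangeRenewal.atomGe π s (n + 1) (j + 1) = 0 := by omega
      simp [h0] at hn
    rw [← map_add_atTop_eq_nat 1]
    exact this
  have hratio : ∀ i j : ℕ, 1 ≤ i → 1 ≤ j → Tendsto (fun n : ℕ =>
      (RangeRenewal.rangeGe s n (i + 1) : ℝ) / RangeRenewal.rangeGe s n (j + 1)) atTop
      (𝓝 (Real.Gamma (i + 1 - γ) / i.factorial / (Real.Gamma (j + 1 - γ) / j.factorial))) := by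
    intro i j hi hj
    rw [← tendsto_add_atTop_iff_nat 1]
    refine ((hω i hi).div (hω j hj) (hC j hj).ne').congr' ?_
    filter_upwards [hcount.eventually_gt_atTop 0] with n hn
    simp only [Pi.div_apply]
    rw [hGe _ i hi, hGe _ j hj, div_div_div_cancel_right₀ hn.ne']
  -- The functional equation of Γ, read as C_{j+1} = C_j (1 - γ/(j + 1)). Exact counts are
  -- differences of consecutive tail counts, so this produces the factor γ/(j + 1) in both limits.
  have hstep : Real.Gamma (((j + 1 : ℕ) : ℝ) + 1 - γ) / (j + 1).factorial =
      Real.Gamma (j + 1 - γ) / j.factorial * (1 - γ / ((j + 1 : ℕ) : ℝ)) := by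
    have : Real.Gamma (((j + 1 : ℕ) : ℝ) + 1 - γ) = (j + 1 - γ) * Real.Gamma (j + 1 - γ) := by
      rw [← Real.Gamma_add_one (by linarith [hγ.2])]; push_cast; ring_nf
    rw [this, Nat.factorial_succ]
    push_cast
    field_simp
  have heq : ∀ n, (RangeRenewal.rangeEq s n (j + 1) : ℝ) =
      RangeRenewal.rangeGe s n (j + 1) - RangeRenewal.rangeGe s n (j + 1 + 1) := fun n => by
    rw [RangeRenewal.rangeGe_eq_add s n (show 1 ≤ j + 1 by omega)]; push_cast; ring
  refine ⟨(hpos 1 le_rfl).and (hpos j hj), ?_, ?_⟩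
  · rw [← RangeRenewal.gamma_limit_eq hj hγ]
    have := (hratio j 1 hj le_rfl).sub (hratio (j + 1) 1 (by omega) le_rfl)
    rw [hstep] at this
    convert! this using 1
    · ext n; rw [heq, sub_div]
    · congr 1
      norm_num
      ring
  · have h0 : (if γ = 0 then 0 else γ / ((j + 1 : ℕ) : ℝ)) = γ / ((j + 1 : ℕ) : ℝ) := by
      split_ifs with h <;> simp [h]
    rw [h0]
    have := (hratio (j + 1) j (by omega) hj).const_sub 1
    rw [hstep, mul_div_cancel_left₀ _ (hC j hj).ne', sub_sub_cancel] at this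
    refine this.congr' ?_
    filter_upwards [hpos j hj] with n hn
    have : (RangeRenewal.rangeGe s n (j + 1) : ℝ) ≠ 0 := by exact_mod_cast hn.ne'
    rw [heq, sub_div, div_self this]
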